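/- Let $B_k$ denote the Bernoulli numbers ($\sum_k B_k x^k/k! = x/(e^x-1)$). For integers $r$ and $s,t\ge 0$ put $$S_{r,s,t}:=\sum_{s\le i_1<\dots<i_r\le t}\frac1{i_1\cdots i_r},$$ with $S_{0,s,t}=1$ if $t\ge s-1$, and $S_{r,s,t}=0$ if $r<0$ or $t<r+s-1$. Let $p\ge 1$ and $q\ge 0$ be integers, and define $$c_{p,q,k,r}:=\frac{B_{2k}}{(2k)!}\,\frac{q!}{(q-2k+1)!}\,\frac{p!}{(p-r)!}\,S_{r,q-2k+2,q}\qquad(2k\le q+1,\ 0\le r\le p),$$ $$d_{p,q,k,r}:=\frac{B_{2k}(-1)^{r+q+1}}{(2k)(2k-1)\cdots(2k-q-1)}\,\frac{p!\,q!}{(p-r)!}\sum_{j=0}^q(-1)^jS_{j,1,q}\,S_{r-j-1,1,2k-q-2}\qquad(2k\ge q+2,\ 1\le r\le p).$$ Then the number $$\mathrm{const}:=(-1)^p\zeta^{(p)}(-q)+\frac{B_{q+1}}{q+1}\,p!\,S_{p,1,q}$$ is real, and the following hold. (a) For every integer $m\ge 0$, as $n\to\infty$, $$\sum_{k=1}^n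 k^q(\log k)^p = n^{q+1}\sum_{r=0}^p\frac{(-1)^rp!}{(p-r)!}\frac{(\log n)^{p-r}}{(q+1)^{r+1}}+\tfrac12 n^q(\log n)^p+\sum_{k=1}^{\lceil q/2\rceil}\Big(\sum_{r=0}^p c_{p,q,k,r}(\log n)^{p-r}\Big)n^{q-2k+1}$$ $$\qquad+\,\mathrm{const}+\sum_{k=\lceil q/2\rceil+1}^m\frac{\sum_{r=1}^p d_{p,q,k,r}(\log n)^{p-r}}{n^{2k-q-1}}+O\Big(\frac{(\log n)^{p-1}}{n^{2m-q}}\Big),$$ where, for odd $q$, the term with $k=\lceil q/2\rceil$, $r=p$ of the sum with the $c_{p,q,k,r}$ (it is independent of $n$ and equals $\frac{B_{q+1}}{q+1}p!\,S_{p,1,q}$) is left out, being already contained in $\mathrm{const}$; the sum with the $d_{p,q,k,r}$ is empty if $m\le\lceil q/2\rceil$. The implied constant depends on $p,q,m$ only. (b) $\mathrm{const}$ is given by the formal (divergent) Euler–Maclaurin series $$\frac{(-1)^{p+1}p!}{(q+1)^{p+1}}-\sum_{k=1}^{\lfloor q/2\rfloor}c_{p,q,k,p}-\sum_{k\ge\lceil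 q/2\rceil+1}d_{p,q,k,p}$$ in the following sense: for every integer $M\ge\lceil q/2\rceil+1$, with $f(x)=x^q(\log x)^p$, $B_{2M}(\cdot)$ the Bernoulli polynomial and $\{x\}$ the fractional part of $x$, the integral below converges absolutely and $$\mathrm{const}=\frac{(-1)^{p+1}p!}{(q+1)^{p+1}}-\sum_{k=1}^{\lfloor q/2\rfloor}c_{p,q,k,p}-\sum_{k=\lceil q/2\rceil+1}^{M}d_{p,q,k,p}-\int_1^\infty\frac{B_{2M}(\{x\})}{(2M)!}f^{(2M)}(x)\,dx .$$ -/

import Mathlib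

open Filter Asymptotics MeasureTheory

noncomputable section

namespace LogPowerSum

/-- `S_{r,s,t}`: the sum of `1 / (i₁ ⋯ i_r)` over integers `s ≤ i₁ < ⋯ < i_r ≤ t`, with
`S_{0,s,t} = 1` if `t ≥ s - 1`, and `S_{r,s,t} = 0` if `r < 0` or `t < r + s - 1`. -/
def S (r : ℤ) (s t : ℕ) : ℝ :=
  if r < 0 ∨ t + 1 < s then 0
  else ∑ A ∈ (Finset.Icc s t).powersetCard r.toNat, ∏ i ∈ A, (1 / (i : ℝ))

/-- `c_{p,q,k,r} = B_{2k}/(2k)! · q!/(q-2k+1)! · p!/(p-r)! · S_{r,q-2k+2,q}`,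
used only for `2k ≤ q + 1` and `r ≤ p`. -/
def c (p q k r : ℕ) : ℝ :=
  (bernoulli (2 * k) : ℝ) / ((2 * k).factorial : ℝ)
    * ((q.factorial : ℝ) / ((q + 1 - 2 * k).factorial : ℝ))
    * ((p.factorial : ℝ) / ((p - r).factorial : ℝ))
    * S r (q + 2 - 2 * k) q

/-- `d_{p,q,k,r} = B_{2k} (-1)^{r+q+1} / ((2k)(2k-1)⋯(2k-q-1)) · p! q!/(p-r)!
  · ∑_{j=0}^q (-1)^j S_{j,1,q} S_{r-j-1,1,2k-q-2}`,
used only for `2k ≥ q + 2` and `r ≤ p`. -/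
def d (p q k r : ℕ) : ℝ :=
  (bernoulli (2 * k) : ℝ) * (-1) ^ (r + q + 1)
      / (∏ i ∈ Finset.range (q + 2), (2 * (k : ℝ) - (i : ℝ)))
    * ((p.factorial : ℝ) * (q.factorial : ℝ) / ((p - r).factorial : ℝ))
    * ∑ j ∈ Finset.range (q + 1), (-1) ^ j * S j 1 q * S ((r : ℤ) - j - 1) 1 (2 * k - q - 2)

/-- The explicit part of the expansion, without the constant term, up to order `m`.
In natural numbers `(q + 1) / 2 = ⌈q/2⌉`. In the first double sum the term that is constant
in `n` (`q` odd, `k = (q+1)/2`, `r = p`) is left out. -/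
def expansion (p q m n : ℕ) : ℝ :=
  (n : ℝ) ^ (q + 1) * ∑ r ∈ Finset.range (p + 1),
      (-1) ^ r * (p.factorial : ℝ) / ((p - r).factorial : ℝ)
        * (Real.log n ^ (p - r) / ((q : ℝ) + 1) ^ (r + 1))
    + 1 / 2 * (n : ℝ) ^ q * Real.log n ^ p
    + ∑ k ∈ Finset.Icc 1 ((q + 1) / 2),
        (∑ r ∈ Finset.range (p + 1),
          if 2 * k = q + 1 ∧ r = p then 0 else c p q k r * Real.log n ^ (p - r))
          * (n : ℝ) ^ (q + 1 - 2 * k)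
    + ∑ k ∈ Finset.Icc ((q + 1) / 2 + 1) m,
        (∑ r ∈ Finset.Icc 1 p, d p q k r * Real.log n ^ (p - r)) / (n : ℝ) ^ (2 * k - q - 1)

/-- The Euler–Maclaurin remainder integrand of order `2M` for `f(x) = x^q (log x)^p`:
`B_{2M}({x}) / (2M)! · f^{(2M)}(x)`. -/
def remainderIntegrand (p q M : ℕ) (x : ℝ) : ℝ :=
  bernoulliFun (2 * M) (Int.fract x) / ((2 * M).factorial : ℝ)
    * iteratedDeriv (2 * M) (fun y : ℝ => y ^ q * Real.log y ^ p) x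

end LogPowerSum

end

/-!
Apply the Euler–Maclaurin formula both to `f x = x ^ q * (log x) ^ p` and to `x ↦ x ^ w` with `w`
complex. As `f` is the `p`-th derivative of `x ^ w` in the exponent, at `w = q`, the power sum of
`f` up to `n` minus the boundary terms at `n` is the `p`-th derivative at `q` of
`Z_n(w) = ∑_{k ≤ n} k ^ w - (boundary terms at n)`. Its increments `Z_{n+1} - Z_n` are remainder
integrals over unit intervals, so `Z_n` converges locally uniformly on
`{w | re w < 2M - 1, w ≠ -1}`. The limit is `ζ(-w)` for `re w < -1`, hence everywhere by the
identity theorem. Therefore the constant is `(-1)^p ζ^{(p)}(-q)` plus the boundary term that is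
independent of `n`, whatever the order `2M`. The coefficients `c` and `d` come out as the Taylor
coefficients at `q` of the falling factorials `w (w - 1) ⋯ (w - 2k + 2)`.
-/

namespace LogPowerSum

/-! ### The Euler–Maclaurin formula -/

/-- The Bernoulli polynomial `B_N(t)` divided by `N!`, normalised so that each one is the
derivative of the next. -/
noncomputable def dividedBernoulli (N : ℕ) (t : ℝ) : ℝ := bernoulliFun N t / (N.factorial : ℝ)

@[fun_prop]
theorem continuous_dividedBernoulli (N : ℕ) : Continuous (dividedBernoulli N) :=
  (continuous_bernoulliFun N).div_const _

theorem hasDerivAt_dividedBernoulli (N : ℕ) (t : ℝ) :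
    HasDerivAt (dividedBernoulli (N + 1)) (dividedBernoulli N t) t := by
  refine ((hasDerivAt_bernoulliFun (N + 1) t).div_const _).congr_deriv ?_
  rw [dividedBernoulli, Nat.factorial_succ, Nat.add_sub_cancel]
  push_cast
  exact mul_div_mul_left _ _ (by positivity)

theorem dividedBernoulli_zero_left (t : ℝ) : dividedBernoulli 0 t = 1 := by
  simp [dividedBernoulli]

theorem dividedBernoulli_zero_right (N : ℕ) :
    dividedBernoulli N 0 = (bernoulli N : ℝ) / (N.factorial : ℝ) := by
  rw [dividedBernoulli, bernoulliFun_eval_zero]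

theorem dividedBernoulli_one_right {N : ℕ} (hN : N ≠ 1) :
    dividedBernoulli N 1 = (bernoulli N : ℝ) / (N.factorial : ℝ) := by
  rw [dividedBernoulli, bernoulliFun_endpoints_eq_of_ne_one hN, bernoulliFun_eval_zero]

theorem exists_abs_dividedBernoulli_fract_le (N : ℕ) :
    ∃ C : ℝ, 0 < C ∧ ∀ x : ℝ, |dividedBernoulli N (Int.fract x)| ≤ C := by
  obtain ⟨C, hC⟩ := isCompact_Icc.exists_bound_of_continuousOn
    (continuous_dividedBernoulli N).continuousOn (s := Set.Icc (0 : ℝ) 1)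
  exact ⟨max C 1, by positivity, fun x =>
    (hC _ ⟨Int.fract_nonneg x, (Int.fract_lt_one x).le⟩).trans (le_max_left _ _)⟩

section EulerMaclaurin

variable {E : Type*} [NormedAddCommGroup E] [NormedSpace ℝ E]

/-- The boundary terms of order `2M` of the Euler–Maclaurin formula for the function `G 1`, where
`G 0` is a primitive of `G 1` and `G (j + 1)` its `j`-th derivative. -/
noncomputable def eulerMaclaurinBoundary (G : ℕ → ℝ → E) (M : ℕ) (x : ℝ) : E :=
  G 0 x + (1 / 2 : ℝ) • G 1 x
    + ∑ k ∈ Finset.Icc 1 M, ((bernoulli (2 * k) : ℝ) / ((2 * k).factorial : ℝ)) • G (2 * k) x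

theorem eulerMaclaurinBoundary_succ (G : ℕ → ℝ → E) (M : ℕ) (x : ℝ) :
    eulerMaclaurinBoundary G (M + 1) x = eulerMaclaurinBoundary G M x
      + ((bernoulli (2 * M + 2) : ℝ) / ((2 * M + 2).factorial : ℝ)) • G (2 * M + 2) x := by
  rw [eulerMaclaurinBoundary, Finset.sum_Icc_succ_top (by lia), ← add_assoc]
  rfl

theorem integral_dividedBernoulli_fract_smul (g : ℝ → E) (N k : ℕ) :
    ∫ x in (k : ℝ)..k + 1, dividedBernoulli N (Int.fract x) • g x
      = ∫ x in (k : ℝ)..k + 1, dividedBernoulli N (x - k) • g x := by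
  have hk : (k : ℝ) ≤ k + 1 := by linarith
  rw [intervalIntegral.integral_of_le hk, intervalIntegral.integral_of_le hk,
    integral_Ioc_eq_integral_Ioo, integral_Ioc_eq_integral_Ioo]
  refine setIntegral_congr_fun measurableSet_Ioo fun x hx => ?_
  have hfract : Int.fract x = x - k :=
    Int.fract_eq_iff.mpr ⟨by linarith [hx.1], by linarith [hx.2], k, by simp⟩
  simp only [hfract]

variable [CompleteSpace E] {G : ℕ → ℝ → E}

section Unit

variable {a : ℝ} (hG : ∀ j, ∀ x ∈ Set.uIcc a (a + 1), HasDerivAt (G j) (G (j + 1) x) x)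

include hG

theorem integral_dividedBernoulli_smul_succ (N : ℕ) :
    ∫ x in a..a + 1, dividedBernoulli (N + 1) (x - a) • G (N + 2) x
      = dividedBernoulli (N + 1) 1 • G (N + 1) (a + 1) - dividedBernoulli (N + 1) 0 • G (N + 1) a
        - ∫ x in a..a + 1, dividedBernoulli N (x - a) • G (N + 1) x := by
  have hderiv (x : ℝ) :
      HasDerivAt (fun x => dividedBernoulli (N + 1) (x - a)) (dividedBernoulli N (x - a)) x :=
    (hasDerivAt_dividedBernoulli N (x - a)).comp_sub_const x a
  have hint : IntervalIntegrable (G (N + 2)) volume a (a + 1) :=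
    ContinuousOn.intervalIntegrable fun x hx => (hG _ x hx).continuousAt.continuousWithinAt
  simpa using intervalIntegral.integral_smul_deriv_eq_deriv_smul
    (fun x _ => hderiv x) (fun x hx => hG (N + 1) x hx)
    ((by fun_prop : Continuous _).intervalIntegrable _ _) hint

theorem integral_dividedBernoulli_smul_two :
    ∫ x in a..a + 1, dividedBernoulli 2 (x - a) • G 3 x
      = eulerMaclaurinBoundary G 1 (a + 1) - eulerMaclaurinBoundary G 1 a - G 1 (a + 1) := by
  have hzero : ∫ x in a..a + 1, dividedBernoulli 0 (x - a) • G 1 x = G 0 (a + 1) - G 0 a := by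
    simp only [dividedBernoulli_zero_left, one_smul]
    exact intervalIntegral.integral_eq_sub_of_hasDerivAt (hG 0) <| ContinuousOn.intervalIntegrable
      fun x hx => (hG 1 x hx).continuousAt.continuousWithinAt
  have hone_left : dividedBernoulli 1 0 = -(1 / 2) := by norm_num [dividedBernoulli]
  have hone_right : dividedBernoulli 1 1 = 1 / 2 := by norm_num [dividedBernoulli]
  rw [integral_dividedBernoulli_smul_succ hG 1, integral_dividedBernoulli_smul_succ hG 0, hzero,
    dividedBernoulli_one_right (by lia), dividedBernoulli_zero_right, hone_left, hone_right]
  simp only [eulerMaclaurinBoundary, Finset.Icc_self, Finset.sum_singleton, mul_one]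
  module

theorem integral_dividedBernoulli_smul_add_two {N : ℕ} (hN : Even N) (hN0 : N ≠ 0) :
    ∫ x in a..a + 1, dividedBernoulli (N + 2) (x - a) • G (N + 3) x
      = ((bernoulli (N + 2) : ℝ) / ((N + 2).factorial : ℝ)) • (G (N + 2) (a + 1) - G (N + 2) a)
        + ∫ x in a..a + 1, dividedBernoulli N (x - a) • G (N + 1) x := by
  have hodd : bernoulli (N + 1) = 0 := bernoulli_eq_zero_of_odd hN.add_one (by lia)
  rw [integral_dividedBernoulli_smul_succ hG (N + 1), integral_dividedBernoulli_smul_succ hG N,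
    dividedBernoulli_one_right (by lia), dividedBernoulli_zero_right,
    dividedBernoulli_one_right (by lia), dividedBernoulli_zero_right, hodd]
  simp only [Rat.cast_zero, zero_div, zero_smul]
  module

theorem eulerMaclaurin_unit {M : ℕ} (hM : 1 ≤ M) :
    G 1 (a + 1) = eulerMaclaurinBoundary G M (a + 1) - eulerMaclaurinBoundary G M a
      - ∫ x in a..a + 1, dividedBernoulli (2 * M) (x - a) • G (2 * M + 1) x := by
  induction M, hM using Nat.le_induction with
  | base =>
    rw [mul_one, integral_dividedBernoulli_smul_two hG]
    abel
  | succ M hM ih =>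
    rw [mul_add_one, integral_dividedBernoulli_smul_add_two hG (even_two_mul M) (by lia),
      eulerMaclaurinBoundary_succ, eulerMaclaurinBoundary_succ]
    conv_lhs => rw [ih]
    module

end Unit

theorem eulerMaclaurin_sum (hG : ∀ j, ∀ x : ℝ, 0 < x → HasDerivAt (G j) (G (j + 1) x) x)
    {M : ℕ} (hM : 1 ≤ M)
    (hint : IntegrableOn (fun x => dividedBernoulli (2 * M) (Int.fract x) • G (2 * M + 1) x)
      (Set.Ioi 1)) {n : ℕ} (hn : 1 ≤ n) :
    ∑ k ∈ Finset.Icc 1 n, G 1 k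
      = G 1 1 + eulerMaclaurinBoundary G M n - eulerMaclaurinBoundary G M 1
        - ∫ x in (1 : ℝ)..n, dividedBernoulli (2 * M) (Int.fract x) • G (2 * M + 1) x := by
  have hii {b c : ℝ} (hb : 1 ≤ b) (hc : 1 ≤ c) : IntervalIntegrable
      (fun x => dividedBernoulli (2 * M) (Int.fract x) • G (2 * M + 1) x) volume b c :=
    intervalIntegrable_iff.mpr <| hint.mono_set fun x hx => (le_min hb hc).trans_lt hx.1
  induction n, hn using Nat.le_induction with
  | base => simp
  | succ n hn ih =>
    have hn' : (1 : ℝ) ≤ n := by exact_mod_cast hn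
    have hunit := eulerMaclaurin_unit (G := G) (a := n)
      (fun j x hx => hG j x (by rw [Set.uIcc_of_le (by linarith)] at hx; linarith [hx.1])) hM
    rw [← integral_dividedBernoulli_fract_smul] at hunit
    rw [Finset.sum_Icc_succ_top (by lia), ih, Nat.cast_succ, hunit,
      ← intervalIntegral.integral_add_adjacent_intervals (hii le_rfl hn')
        (hii hn' (by linarith : (1 : ℝ) ≤ n + 1))]
    abel

end EulerMaclaurin

/-! ### Derivatives of powers times powers of the logarithm -/

section LogSum

open Polynomial (taylor)
open PowerSeries

/-- The polynomial in `log x` which is, by Leibniz' rule, the `p`-th derivative at `ε = 0` of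
`x ^ ε * A(ε)`. -/
noncomputable def logSum (p : ℕ) (A : PowerSeries ℝ) (x : ℝ) : ℝ :=
  ∑ r ∈ Finset.range (p + 1),
    (p.factorial : ℝ) / ((p - r).factorial : ℝ) * coeff r A * Real.log x ^ (p - r)

theorem logSum_add (p : ℕ) (A B : PowerSeries ℝ) (x : ℝ) :
    logSum p (A + B) x = logSum p A x + logSum p B x := by
  simp only [logSum, map_add, mul_add, add_mul, Finset.sum_add_distrib]

theorem logSum_C_mul (p : ℕ) (b : ℝ) (A : PowerSeries ℝ) (x : ℝ) :
    logSum p (C b * A) x = b * logSum p A x := by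
  simp only [logSum, coeff_C_mul, Finset.mul_sum]
  exact Finset.sum_congr rfl fun r _ => by ring

theorem logSum_one_left (p : ℕ) (x : ℝ) : logSum p 1 x = Real.log x ^ p := by
  rw [logSum, Finset.sum_eq_single_of_mem 0 (by simp) fun r _ hr => by simp [coeff_one, hr]]
  simp [p.factorial_ne_zero]

theorem hasDerivAt_logSum (p : ℕ) (A : PowerSeries ℝ) {x : ℝ} (hx : x ≠ 0) :
    HasDerivAt (logSum p A) (logSum p (X * A) x * x⁻¹) x := by
  have hterm : HasDerivAt (logSum p A) (∑ r ∈ Finset.range (p + 1),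
      (p.factorial : ℝ) / ((p - r).factorial : ℝ) * coeff r A
        * ((p - r : ℕ) * Real.log x ^ (p - r - 1) * x⁻¹)) x :=
    HasDerivAt.fun_sum fun r _ => ((Real.hasDerivAt_log hx).pow (p - r)).const_mul _
  refine hterm.congr_deriv ?_
  rw [logSum, Finset.sum_mul, Finset.sum_range_succ, Finset.sum_range_succ' (n := p)]
  simp only [Nat.sub_self, Nat.cast_zero, zero_mul, mul_zero, coeff_zero_X_mul, add_zero]
  refine Finset.sum_congr rfl fun r hr => ?_
  obtain ⟨s, hs⟩ := Nat.exists_eq_add_of_lt (Finset.mem_range.mp hr)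
  rw [show p - r = s + 1 by lia, show p - (r + 1) = s by lia, Nat.factorial_succ s,
    coeff_succ_X_mul, Nat.add_sub_cancel]
  push_cast
  field_simp

theorem hasDerivAt_logSum_mul_zpow (p : ℕ) (A : PowerSeries ℝ) (e : ℤ) {x : ℝ} (hx : x ≠ 0) :
    HasDerivAt (fun y => logSum p A y * y ^ e)
      (logSum p ((X + C (e : ℝ)) * A) x * x ^ (e - 1)) x := by
  refine ((hasDerivAt_logSum p A hx).mul (hasDerivAt_zpow e x (Or.inl hx))).congr_deriv ?_
  rw [add_mul, logSum_add, logSum_C_mul, zpow_sub_one₀ hx]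
  ring

theorem coeff_X_add_C_inv {K : Type*} [Field K] {b : K} (hb : b ≠ 0) (r : ℕ) :
    coeff r (X + C b)⁻¹ = (-1) ^ r / b ^ (r + 1) := by
  suffices hinv : (X + C b)⁻¹ = PowerSeries.mk fun r => (-1) ^ r / b ^ (r + 1) by
    rw [hinv, coeff_mk]
  rw [PowerSeries.inv_eq_iff_mul_eq_one (by simpa)]
  ext (_ | r)
  · simp [mul_add, hb]
  · simp only [mul_add, map_add, coeff_succ_mul_X, coeff_mul_C, coeff_mk, coeff_one,
      Nat.add_eq_zero_iff, one_ne_zero, and_false, if_false]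
    field_simp
    ring

theorem taylor_descPochhammer {R : Type*} [CommRing R] (a : R) (j : ℕ) :
    taylor a (descPochhammer R j)
      = ∏ i ∈ Finset.range j, (Polynomial.X + Polynomial.C (a - i)) := by
  induction j with
  | zero => simp
  | succ j ih =>
    rw [descPochhammer_succ_right, Polynomial.taylor_mul, ih, Finset.prod_range_succ, map_sub,
      Polynomial.taylor_X, ← Polynomial.C_eq_natCast, Polynomial.taylor_C, add_sub_assoc,
      ← Polynomial.C_sub]

theorem coe_taylor_descPochhammer_succ {R : Type*} [CommRing R] (a : R) (j : ℕ) :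
    (taylor a (descPochhammer R (j + 1)) : PowerSeries R)
      = (X + C (a - j)) * (taylor a (descPochhammer R j) : PowerSeries R) := by
  rw [taylor_descPochhammer, Finset.prod_range_succ, ← taylor_descPochhammer, mul_comm,
    Polynomial.coe_mul, Polynomial.coe_add, Polynomial.coe_X, Polynomial.coe_C]

/-- A primitive of `x ^ q * (log x) ^ p` on `x > 0`, followed by this function and its successive
derivatives. These are the `p`-th derivatives at `w = q` of `x ^ (w + 1) / (w + 1)` and of
`w * (w - 1) * ⋯ * (w - j + 1) * x ^ (w - j)`, expanded with `ε = w - q`. -/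
noncomputable def logPowDeriv (p q : ℕ) : ℕ → ℝ → ℝ
  | 0, x => logSum p (X + C ((q : ℝ) + 1))⁻¹ x * x ^ ((q : ℤ) + 1)
  | j + 1, x => logSum p (taylor (q : ℝ) (descPochhammer ℝ j)) x * x ^ ((q : ℤ) - j)

theorem logPowDeriv_one (p q : ℕ) (x : ℝ) :
    logPowDeriv p q 1 x = x ^ q * Real.log x ^ p := by
  simp [logPowDeriv, logSum_one_left, mul_comm]

theorem hasDerivAt_logPowDeriv (p q j : ℕ) {x : ℝ} (hx : x ≠ 0) :
    HasDerivAt (logPowDeriv p q j) (logPowDeriv p q (j + 1) x) x := by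
  cases j with
  | zero =>
    refine (hasDerivAt_logSum_mul_zpow p _ ((q : ℤ) + 1) hx).congr_deriv ?_
    have hinv : (X + C ((q : ℝ) + 1)) * (X + C ((q : ℝ) + 1))⁻¹ = 1 :=
      PowerSeries.mul_inv_cancel _ (by simpa using Nat.cast_add_one_ne_zero q)
    push_cast
    rw [hinv]
    simp [logPowDeriv]
  | succ j =>
    refine (hasDerivAt_logSum_mul_zpow p _ ((q : ℤ) - j) hx).congr_deriv ?_
    rw [logPowDeriv, coe_taylor_descPochhammer_succ]
    push_cast
    rw [sub_sub]

theorem iteratedDeriv_pow_mul_log_pow (p q j : ℕ) {x : ℝ} (hx : x ≠ 0) :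
    iteratedDeriv j (fun y : ℝ => y ^ q * Real.log y ^ p) x = logPowDeriv p q (j + 1) x := by
  induction j generalizing x with
  | zero => rw [iteratedDeriv_zero, logPowDeriv_one]
  | succ j ih =>
    have heq : iteratedDeriv j (fun y : ℝ => y ^ q * Real.log y ^ p)
        =ᶠ[nhds x] logPowDeriv p q (j + 1) := by
      filter_upwards [isOpen_ne.mem_nhds hx] with y hy using ih hy
    rw [iteratedDeriv_succ, heq.deriv_eq, (hasDerivAt_logPowDeriv p q (j + 1) hx).deriv]

end LogSum

/-! ### The coefficients as Taylor coefficients of falling factorials -/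

section Coefficients

open Polynomial

theorem coeff_prod_one_add_C_mul_X {R ι : Type*} [CommSemiring R] (s : Finset ι) (b : ι → R)
    (r : ℕ) :
    (∏ i ∈ s, (1 + C (b i) * X)).coeff r = ∑ A ∈ s.powersetCard r, ∏ i ∈ A, b i := by
  classical
  rw [Finset.prod_one_add, finsetSum_coeff, Finset.powersetCard_eq_filter, Finset.sum_filter]
  simp only [Finset.prod_mul_distrib, Finset.prod_const, ← map_prod, coeff_C_mul_X_pow, eq_comm]

/-- `∏ (1 + (ε / i) X)` over `s ≤ i ≤ t`, the generating polynomial of the numbers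
`ε ^ r * S_{r,s,t}`. -/
noncomputable def genS (ε : ℝ) (s t : ℕ) : ℝ[X] := ∏ i ∈ Finset.Icc s t, (1 + C (ε / i) * X)

theorem coeff_genS (ε : ℝ) (r : ℕ) {s t : ℕ} (h : s ≤ t + 1) :
    (genS ε s t).coeff r = ε ^ r * S r s t := by
  rw [genS, coeff_prod_one_add_C_mul_X, S, if_neg (by lia), Int.toNat_natCast, Finset.mul_sum]
  refine Finset.sum_congr rfl fun A hA => ?_
  rw [← (Finset.mem_powersetCard.mp hA).2, ← Finset.prod_const, ← Finset.prod_mul_distrib]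
  exact Finset.prod_congr rfl fun i _ => (mul_one_div _ _).symm

theorem S_of_neg {r : ℤ} (hr : r < 0) (s t : ℕ) : S r s t = 0 := if_pos (Or.inl hr)

theorem S_one_eq_zero_of_lt {r t : ℕ} (h : t < r) : S r 1 t = 0 := by
  rw [S, if_neg (by lia), Int.toNat_natCast, Finset.powersetCard_eq_empty.2 (by simpa using h),
    Finset.sum_empty]

theorem coeff_genS_one_mul_genS_neg_one (q t r : ℕ) :
    (genS 1 1 q * genS (-1) 1 t).coeff r
      = (-1) ^ r * ∑ j ∈ Finset.range (q + 1), (-1) ^ j * S j 1 q * S ((r : ℤ) - j) 1 t := by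
  have hrange : ∑ j ∈ Finset.range (q + 1), (-1 : ℝ) ^ j * S j 1 q * S ((r : ℤ) - j) 1 t
      = ∑ j ∈ Finset.range (r + 1), (-1 : ℝ) ^ j * S j 1 q * S ((r : ℤ) - j) 1 t := by
    trans ∑ j ∈ Finset.range (q + r + 1), (-1 : ℝ) ^ j * S j 1 q * S ((r : ℤ) - j) 1 t
    · refine Finset.sum_subset (Finset.range_mono (by lia)) fun j _ hj => ?_
      rw [S_one_eq_zero_of_lt (r := j) (by simpa using hj), mul_zero, zero_mul]
    · refine (Finset.sum_subset (Finset.range_mono (by lia)) fun j _ hj => ?_).symm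
      rw [S_of_neg (r := r - j) (by rw [Finset.mem_range] at hj; lia), mul_zero]
  rw [hrange, coeff_mul, Finset.Nat.sum_antidiagonal_eq_sum_range_succ_mk, Finset.mul_sum]
  refine Finset.sum_congr rfl fun j hj => ?_
  obtain ⟨u, rfl⟩ := Nat.exists_eq_add_of_le (Finset.mem_range_succ_iff.mp hj)
  have hsign : (-1 : ℝ) ^ (j + u) * (-1) ^ j = (-1) ^ u := by
    rw [pow_add, mul_right_comm, ← mul_pow]
    simp
  rw [coeff_genS _ _ (by lia), coeff_genS _ _ (by lia), Nat.add_sub_cancel_left, ← hsign,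
    show ((j + u : ℕ) : ℤ) - j = u by lia]
  ring

theorem prod_Icc_X_add_C_mul {ε : ℝ} (hε : ε * ε = 1) {s : ℕ} (hs : 1 ≤ s) (t : ℕ) :
    ∏ i ∈ Finset.Icc s t, (X + C (ε * i)) = C (∏ i ∈ Finset.Icc s t, ε * i) * genS ε s t := by
  rw [genS, map_prod, ← Finset.prod_mul_distrib]
  refine Finset.prod_congr rfl fun i hi => ?_
  have hi0 : (i : ℝ) ≠ 0 := by
    rw [Finset.mem_Icc] at hi
    exact_mod_cast (by lia : i ≠ 0)
  have hcancel : ε * i * (ε / i) = 1 := by rw [← hε]; field_simp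
  rw [mul_add, ← mul_assoc, ← C_mul, hcancel, mul_one, C_1, one_mul, add_comm]

theorem taylor_descPochhammer_of_le {q j : ℕ} (h : j ≤ q) :
    taylor (q : ℝ) (descPochhammer ℝ j)
      = C ((q.factorial : ℝ) / ((q - j).factorial : ℝ)) * genS 1 (q + 1 - j) q := by
  have hreflect {M : Type} [CommMonoid M] (f : ℕ → M) :
      ∏ i ∈ Finset.range j, f (q - i) = ∏ i ∈ Finset.Icc (q + 1 - j) q, f i := by
    rw [Finset.range_eq_Ico, Finset.prod_Ico_reflect f 0 (by lia)]
    rfl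
  have hfactorial : ∏ i ∈ Finset.Icc (q + 1 - j) q, (1 * (i : ℝ))
      = (q.factorial : ℝ) / ((q - j).factorial : ℝ) := by
    rw [eq_div_iff (by positivity), ← Nat.factorial_mul_descFactorial h,
      Nat.descFactorial_eq_prod_range, hreflect fun i => i]
    simp only [one_mul, Nat.cast_mul, Nat.cast_prod]
    exact mul_comm _ _
  rw [taylor_descPochhammer, ← hfactorial, ← prod_Icc_X_add_C_mul (one_mul 1) (by lia),
    ← hreflect fun i : ℕ => (X + C (1 * (i : ℝ)))]
  refine Finset.prod_congr rfl fun i hi => ?_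
  rw [one_mul, Nat.cast_sub ((Finset.mem_range.mp hi).le.trans h)]

theorem taylor_descPochhammer_add (q t : ℕ) :
    taylor (q : ℝ) (descPochhammer ℝ (q + 1 + t))
      = C ((q.factorial : ℝ) * ((-1) ^ t * (t.factorial : ℝ)))
        * (X * (genS 1 1 q * genS (-1) 1 t)) := by
  have hlow : ∏ i ∈ Finset.range q, (X + C ((q : ℝ) - i)) = C (q.factorial : ℝ) * genS 1 1 q := by
    rw [← taylor_descPochhammer, taylor_descPochhammer_of_le le_rfl]
    simp
  have hhigh : ∏ i ∈ Finset.range t, (X + C ((q : ℝ) - (q + 1 + i : ℕ)))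
      = C ((-1) ^ t * (t.factorial : ℝ)) * genS (-1) 1 t := by
    have hfactorial : ∏ i ∈ Finset.Icc 1 t, (-1 * (i : ℝ)) = (-1) ^ t * (t.factorial : ℝ) := by
      rw [Finset.prod_mul_distrib, Finset.prod_const, Nat.card_Icc, Nat.add_sub_cancel,
        ← Finset.prod_Ico_id_eq_factorial, Nat.cast_prod]
      rfl
    rw [← hfactorial, ← prod_Icc_X_add_C_mul (by norm_num) le_rfl,
      ← Finset.Ico_add_one_right_eq_Icc, Finset.prod_Ico_eq_prod_range, Nat.add_sub_cancel]
    refine Finset.prod_congr rfl fun i _ => ?_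
    push_cast
    ring_nf
  rw [taylor_descPochhammer, Finset.prod_range_add, Finset.prod_range_succ, hlow, hhigh, sub_self,
    C_0, add_zero, C_mul (a := (q.factorial : ℝ))]
  ring

theorem c_eq_coeff_taylor {q k : ℕ} (hk : 1 ≤ k) (hkq : 2 * k ≤ q + 1) (p r : ℕ) :
    c p q k r = (bernoulli (2 * k) : ℝ) / ((2 * k).factorial : ℝ)
      * ((p.factorial : ℝ) / ((p - r).factorial : ℝ)
        * (taylor (q : ℝ) (descPochhammer ℝ (2 * k - 1))).coeff r) := by
  rw [taylor_descPochhammer_of_le (by lia), coeff_C_mul, coeff_genS _ _ (by lia), one_pow,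
    show q + 1 - (2 * k - 1) = q + 2 - 2 * k by lia,
    show q - (2 * k - 1) = q + 1 - 2 * k by lia, c]
  ring

theorem prod_range_natCast_sub_eq_div_factorial (j t : ℕ) :
    ∏ i ∈ Finset.range j, (((j + t : ℕ) : ℝ) - i)
      = ((j + t).factorial : ℝ) / (t.factorial : ℝ) := by
  rw [← descPochhammer_eval_eq_prod_range, descPochhammer_eval_eq_descFactorial,
    eq_div_iff (by positivity), mul_comm, ← Nat.factorial_mul_descFactorial (by lia : j ≤ j + t)]
  simp

theorem d_eq_coeff_taylor {q k r : ℕ} (hkq : q + 2 ≤ 2 * k) (hr : 1 ≤ r) (p : ℕ) :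
    d p q k r = (bernoulli (2 * k) : ℝ) / ((2 * k).factorial : ℝ)
      * ((p.factorial : ℝ) / ((p - r).factorial : ℝ)
        * (taylor (q : ℝ) (descPochhammer ℝ (2 * k - 1))).coeff r) := by
  obtain ⟨t, ht⟩ := Nat.exists_eq_add_of_le hkq
  obtain ⟨r, rfl⟩ := Nat.exists_eq_add_of_le' hr
  have hden : ∏ i ∈ Finset.range (q + 2), (2 * (k : ℝ) - (i : ℝ))
      = ((2 * k).factorial : ℝ) / (t.factorial : ℝ) := by
    rw [ht, ← prod_range_natCast_sub_eq_div_factorial, ← ht]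
    push_cast
    rfl
  have hsign : (-1 : ℝ) ^ (r + 1 + q + 1) = (-1) ^ t * (-1) ^ r := by
    rw [← pow_add]
    exact neg_one_pow_congr (by rw [Nat.even_iff, Nat.even_iff]; lia)
  have hindex (j : ℕ) : ((r + 1 : ℕ) : ℤ) - j - 1 = r - j := by lia
  rw [show 2 * k - 1 = q + 1 + t by lia, taylor_descPochhammer_add, coeff_C_mul, coeff_X_mul,
    coeff_genS_one_mul_genS_neg_one, d, hden, hsign, show 2 * k - q - 2 = t by lia]
  simp only [hindex]
  field_simp

end Coefficients

/-! ### The boundary terms as the explicit expansion -/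

section Expansion

open Polynomial (taylor)

theorem logPowDeriv_zero (p q : ℕ) (x : ℝ) :
    logPowDeriv p q 0 x = x ^ (q + 1) * ∑ r ∈ Finset.range (p + 1),
      (-1) ^ r * (p.factorial : ℝ) / ((p - r).factorial : ℝ)
        * (Real.log x ^ (p - r) / ((q : ℝ) + 1) ^ (r + 1)) := by
  rw [logPowDeriv, logSum, mul_comm, ← Nat.cast_succ, zpow_natCast]
  congr 1
  refine Finset.sum_congr rfl fun r _ => ?_
  rw [coeff_X_add_C_inv (by positivity)]
  ring

theorem bernoulli_mul_logPowDeriv_of_le {q k : ℕ} (hk : 1 ≤ k) (hkq : 2 * k ≤ q + 1) (p : ℕ)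
    (x : ℝ) :
    (bernoulli (2 * k) : ℝ) / ((2 * k).factorial : ℝ) * logPowDeriv p q (2 * k) x
      = (∑ r ∈ Finset.range (p + 1), c p q k r * Real.log x ^ (p - r)) * x ^ (q + 1 - 2 * k) := by
  obtain ⟨j, hj⟩ := Nat.exists_eq_add_of_le' (show 1 ≤ 2 * k by lia)
  simp only [c_eq_coeff_taylor hk hkq]
  rw [hj, Nat.add_sub_cancel, logPowDeriv, logSum, ← mul_assoc, Finset.mul_sum, ← zpow_natCast,
    show ((q + 1 - (j + 1) : ℕ) : ℤ) = (q : ℤ) - j by lia]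
  congr 1
  refine Finset.sum_congr rfl fun r _ => ?_
  rw [Polynomial.coeff_coe]
  ring

theorem coeff_zero_taylor_descPochhammer_of_lt {q j : ℕ} (h : q < j) :
    (taylor (q : ℝ) (descPochhammer ℝ j)).coeff 0 = 0 := by
  rw [Polynomial.taylor_coeff_zero, descPochhammer_eval_eq_descFactorial,
    Nat.descFactorial_of_lt h, Nat.cast_zero]

theorem bernoulli_mul_logPowDeriv_of_lt {q k : ℕ} (hkq : q + 2 ≤ 2 * k) (p : ℕ) (x : ℝ) :
    (bernoulli (2 * k) : ℝ) / ((2 * k).factorial : ℝ) * logPowDeriv p q (2 * k) x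
      = (∑ r ∈ Finset.Icc 1 p, d p q k r * Real.log x ^ (p - r)) / x ^ (2 * k - q - 1) := by
  obtain ⟨j, hj⟩ := Nat.exists_eq_add_of_le' (show 1 ≤ 2 * k by lia)
  have hsum : logSum p (taylor (q : ℝ) (descPochhammer ℝ j)) x = ∑ r ∈ Finset.Icc 1 p,
      (p.factorial : ℝ) / ((p - r).factorial : ℝ) * (taylor (q : ℝ) (descPochhammer ℝ j)).coeff r
        * Real.log x ^ (p - r) := by
    simp only [logSum, Polynomial.coeff_coe]
    rw [Finset.range_eq_Ico, Finset.sum_eq_sum_Ico_succ_bot (by lia),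
      coeff_zero_taylor_descPochhammer_of_lt (by lia), mul_zero, zero_mul, zero_add]
    rfl
  rw [Finset.sum_congr rfl fun r hr => by rw [d_eq_coeff_taylor hkq (Finset.mem_Icc.1 hr).1], hj,
    logPowDeriv, hsum, Nat.add_sub_cancel, div_eq_mul_inv _ (x ^ _), ← zpow_natCast, ← zpow_neg,
    show -((j + 1 - q - 1 : ℕ) : ℤ) = (q : ℤ) - j by lia, ← mul_assoc, Finset.mul_sum]
  congr 1
  exact Finset.sum_congr rfl fun r _ => by ring

theorem sum_range_ite_c_mul_pow (p q k : ℕ) (L : ℝ) :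
    (∑ r ∈ Finset.range (p + 1), if 2 * k = q + 1 ∧ r = p then 0 else c p q k r * L ^ (p - r))
      = ∑ r ∈ Finset.range (p + 1), c p q k r * L ^ (p - r)
        - if 2 * k = q + 1 then c p q k p else 0 := by
  rw [Finset.sum_range_succ, Finset.sum_range_succ (n := p), Finset.sum_congr rfl fun r hr =>
    if_neg fun h => (Finset.mem_range.mp hr).ne h.2]
  split_ifs <;> simp_all

/-- The part of the boundary terms of `x ^ q * (log x) ^ p` at `n` that is constant in `n`. It is
non-zero only for odd `q`, where it is the term with `k = (q + 1) / 2` and `r = p`. -/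
noncomputable def boundaryConstant (p q : ℕ) : ℝ :=
  (bernoulli (q + 1) : ℝ) / ((q : ℝ) + 1) * (p.factorial : ℝ) * S p 1 q

theorem sum_ite_c_eq_boundaryConstant {p : ℕ} (hp : 1 ≤ p) (q : ℕ) :
    ∑ k ∈ Finset.Icc 1 ((q + 1) / 2), (if 2 * k = q + 1 then c p q k p else 0)
      = boundaryConstant p q := by
  rcases Nat.even_or_odd' q with ⟨u, rfl | rfl⟩
  · rw [Finset.sum_eq_zero fun k _ => if_neg (by lia), boundaryConstant]
    rcases Nat.eq_zero_or_pos u with rfl | hu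
    · rw [S_one_eq_zero_of_lt (by lia), mul_zero]
    · rw [bernoulli_eq_zero_of_odd ⟨u, rfl⟩ (by lia)]
      simp
  · rw [Finset.sum_eq_single_of_mem (u + 1) (Finset.mem_Icc.2 ⟨by lia, by lia⟩)
      fun k _ hk => if_neg (by lia), if_pos (by ring), boundaryConstant, c,
      show 2 * (u + 1) = 2 * u + 1 + 1 by ring, Nat.sub_self, Nat.sub_self,
      show 2 * u + 1 + 2 - (2 * u + 1 + 1) = 1 by lia, Nat.factorial_succ (2 * u + 1)]
    push_cast
    simp only [Nat.factorial_zero, Nat.cast_one, div_one]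
    field_simp

theorem sum_c_sub_ite (p q : ℕ) :
    ∑ k ∈ Finset.Icc 1 ((q + 1) / 2), (c p q k p - if 2 * k = q + 1 then c p q k p else 0)
      = ∑ k ∈ Finset.Icc 1 (q / 2), c p q k p := by
  refine (Finset.sum_subset_zero_on_sdiff (Finset.Icc_subset_Icc le_rfl (by lia)) ?_ ?_).symm
  · intro k hk
    simp only [Finset.mem_sdiff, Finset.mem_Icc] at hk
    rw [if_pos (by lia), sub_self]
  · intro k hk
    rw [Finset.mem_Icc] at hk
    rw [if_neg (by lia), sub_zero]

theorem sum_bernoulli_mul_logPowDeriv_of_le {p : ℕ} (hp : 1 ≤ p) (q : ℕ) (x : ℝ) :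
    ∑ k ∈ Finset.Icc 1 ((q + 1) / 2),
        (bernoulli (2 * k) : ℝ) / ((2 * k).factorial : ℝ) * logPowDeriv p q (2 * k) x
      = ∑ k ∈ Finset.Icc 1 ((q + 1) / 2),
          (∑ r ∈ Finset.range (p + 1),
            if 2 * k = q + 1 ∧ r = p then 0 else c p q k r * Real.log x ^ (p - r))
            * x ^ (q + 1 - 2 * k)
        + boundaryConstant p q := by
  rw [← sum_ite_c_eq_boundaryConstant hp, ← Finset.sum_add_distrib]
  refine Finset.sum_congr rfl fun k hk => ?_
  rw [Finset.mem_Icc] at hk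
  rw [bernoulli_mul_logPowDeriv_of_le hk.1 (by lia), sum_range_ite_c_mul_pow]
  split_ifs with hkq
  · rw [hkq, Nat.sub_self]
    ring
  · ring

theorem eulerMaclaurinBoundary_logPowDeriv {p q M : ℕ} (hp : 1 ≤ p) (hM : (q + 1) / 2 ≤ M)
    (n : ℕ) :
    eulerMaclaurinBoundary (logPowDeriv p q) M n = expansion p q M n + boundaryConstant p q := by
  have hhigh : ∑ k ∈ Finset.Icc ((q + 1) / 2 + 1) M,
        (bernoulli (2 * k) : ℝ) / ((2 * k).factorial : ℝ) * logPowDeriv p q (2 * k) n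
      = ∑ k ∈ Finset.Icc ((q + 1) / 2 + 1) M,
        (∑ r ∈ Finset.Icc 1 p, d p q k r * Real.log n ^ (p - r)) / (n : ℝ) ^ (2 * k - q - 1) :=
    Finset.sum_congr rfl fun k hk =>
      bernoulli_mul_logPowDeriv_of_lt (by rw [Finset.mem_Icc] at hk; lia) p n
  have hsplit (f : ℕ → ℝ) : ∑ k ∈ Finset.Icc 1 M, f k
      = ∑ k ∈ Finset.Icc 1 ((q + 1) / 2), f k + ∑ k ∈ Finset.Icc ((q + 1) / 2 + 1) M, f k := by
    have hIcc (b : ℕ) : Finset.Icc 1 b = Finset.Ioc 0 b := Finset.Icc_add_one_left_eq_Ioc 0 b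
    rw [hIcc, hIcc, Finset.Icc_add_one_left_eq_Ioc,
      Finset.sum_Ioc_consecutive f (Nat.zero_le _) hM]
  simp only [eulerMaclaurinBoundary, smul_eq_mul]
  rw [hsplit, sum_bernoulli_mul_logPowDeriv_of_le hp, hhigh, logPowDeriv_zero, logPowDeriv_one,
    expansion]
  ring

theorem sum_range_mul_zero_pow (g : ℕ → ℝ) (p : ℕ) :
    ∑ r ∈ Finset.range (p + 1), g r * 0 ^ (p - r) = g p := by
  rw [Finset.sum_range_succ, Finset.sum_eq_zero fun r hr => by
    rw [zero_pow (Nat.sub_ne_zero_of_lt (Finset.mem_range.mp hr)), mul_zero]]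
  simp

theorem expansion_one {p : ℕ} (hp : 1 ≤ p) (q M : ℕ) :
    expansion p q M 1 = -((-1) ^ (p + 1) * (p.factorial : ℝ) / ((q : ℝ) + 1) ^ (p + 1)
      - ∑ k ∈ Finset.Icc 1 (q / 2), c p q k p
      - ∑ k ∈ Finset.Icc ((q + 1) / 2 + 1) M, d p q k p) := by
  have hlead : ∑ r ∈ Finset.range (p + 1), (-1) ^ r * (p.factorial : ℝ) / ((p - r).factorial : ℝ)
        * ((0 : ℝ) ^ (p - r) / ((q : ℝ) + 1) ^ (r + 1))
      = (-1) ^ p * (p.factorial : ℝ) / ((q : ℝ) + 1) ^ (p + 1) := by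
    simp only [← mul_div_assoc, mul_div_right_comm _ ((0 : ℝ) ^ _), sum_range_mul_zero_pow,
      Nat.sub_self, Nat.factorial_zero, Nat.cast_one, div_one]
  have hhigh (k : ℕ) : ∑ r ∈ Finset.Icc 1 p, d p q k r * (0 : ℝ) ^ (p - r) = d p q k p := by
    rw [Finset.sum_eq_single_of_mem p (Finset.mem_Icc.2 ⟨hp, le_rfl⟩) fun r hr hne => by
      rw [zero_pow (by rw [Finset.mem_Icc] at hr; lia), mul_zero]]
    simp
  simp only [expansion, Nat.cast_one, Real.log_one, one_pow, mul_one, div_one, one_mul, hlead,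
    sum_range_ite_c_mul_pow, sum_range_mul_zero_pow, sum_c_sub_ite, hhigh]
  rw [zero_pow (by lia)]
  ring

end Expansion

/-! ### The remainder integral -/

theorem isBigO_log_pow_rpow (k : ℕ) {s : ℝ} (hs : 0 < s) :
    (fun x => Real.log x ^ k) =O[atTop] fun x : ℝ => x ^ s := by
  simpa only [Real.rpow_natCast] using (isLittleO_log_rpow_rpow_atTop k hs).isBigO

theorem logSum_isBigO_rpow (p : ℕ) (A : PowerSeries ℝ) {s : ℝ} (hs : 0 < s) :
    logSum p A =O[atTop] fun x : ℝ => x ^ s :=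
  IsBigO.fun_sum fun _ _ => (isBigO_log_pow_rpow _ hs).const_mul_left _

theorem logPowDeriv_succ_isBigO_rpow (p q j : ℕ) {s : ℝ} (hs : 0 < s) :
    logPowDeriv p q (j + 1) =O[atTop] fun x : ℝ => x ^ ((q : ℝ) - j + s) := by
  refine ((logSum_isBigO_rpow p _ hs).mul (isBigO_refl _ _)).congr' EventuallyEq.rfl ?_
  filter_upwards [eventually_gt_atTop 0] with x hx
  rw [add_comm, Real.rpow_add hx, ← Real.rpow_intCast]
  push_cast
  rfl

theorem remainderIntegrand_eq (p q M : ℕ) {x : ℝ} (hx : x ≠ 0) :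
    remainderIntegrand p q M x
      = dividedBernoulli (2 * M) (Int.fract x) * logPowDeriv p q (2 * M + 1) x := by
  rw [remainderIntegrand, iteratedDeriv_pow_mul_log_pow p q (2 * M) hx, dividedBernoulli]

theorem remainderIntegrand_isBigO_rpow (p q M : ℕ) {s : ℝ} (hs : 0 < s) :
    remainderIntegrand p q M =O[atTop] fun x : ℝ => x ^ ((q : ℝ) - 2 * M + s) := by
  obtain ⟨C, -, hC⟩ := exists_abs_dividedBernoulli_fract_le (2 * M)
  have hB : (fun x => dividedBernoulli (2 * M) (Int.fract x)) =O[atTop] fun _ => (1 : ℝ) :=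
    IsBigO.of_bound C (Eventually.of_forall fun x => by simpa using hC x)
  refine (hB.mul (logPowDeriv_succ_isBigO_rpow p q (2 * M) hs)).congr' ?_ ?_
  · filter_upwards [eventually_ne_atTop 0] with x hx using (remainderIntegrand_eq p q M hx).symm
  · exact Eventually.of_forall fun x => by simp

theorem integrableOn_logPowDeriv {p q j : ℕ} (hj : q + 1 < j) :
    IntegrableOn (logPowDeriv p q (j + 1)) (Set.Ici 1) := by
  have hcont : ContinuousOn (logPowDeriv p q (j + 1)) (Set.Ici 1) := fun x hx =>
    (hasDerivAt_logPowDeriv p q _ (zero_lt_one.trans_le hx).ne').continuousAt.continuousWithinAt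
  have hexp : (q : ℝ) - j + 1 / 2 < -1 := by
    have : (q : ℝ) + 2 ≤ j := by exact_mod_cast hj
    linarith
  exact (hcont.locallyIntegrableOn measurableSet_Ici).integrableOn_of_isBigO_atTop
    (logPowDeriv_succ_isBigO_rpow p q j one_half_pos) (integrableAtFilter_rpow_atTop_iff.2 hexp)

theorem integrableOn_remainderIntegrand (p : ℕ) {q M : ℕ} (hM : (q + 1) / 2 < M) :
    IntegrableOn (remainderIntegrand p q M) (Set.Ioi 1) := by
  obtain ⟨C, -, hC⟩ := exists_abs_dividedBernoulli_fract_le (2 * M)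
  have hmeas : Measurable fun x => dividedBernoulli (2 * M) (Int.fract x) :=
    (continuous_dividedBernoulli _).measurable.comp measurable_fract
  have hint : IntegrableOn (logPowDeriv p q (2 * M + 1)) (Set.Ioi 1) :=
    (integrableOn_logPowDeriv (by lia)).mono_set Set.Ioi_subset_Ici_self
  have hprod : IntegrableOn (fun x => dividedBernoulli (2 * M) (Int.fract x)
      * logPowDeriv p q (2 * M + 1) x) (Set.Ioi 1) :=
    hint.bdd_mul hmeas.aestronglyMeasurable (Eventually.of_forall hC)
  exact hprod.congr_fun
    (fun x hx => (remainderIntegrand_eq p q M (zero_lt_one.trans hx).ne').symm) measurableSet_Ioi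

theorem integral_Ioi_isBigO_rpow {E : Type*} [NormedAddCommGroup E] [NormedSpace ℝ E]
    {f : ℝ → E} {s : ℝ} (hs : s < -1) (hf : f =O[atTop] fun x : ℝ => x ^ s) :
    (fun a => ∫ x in Set.Ioi a, f x) =O[atTop] fun a : ℝ => a ^ (s + 1) := by
  obtain ⟨C, hC⟩ := hf.bound
  obtain ⟨b, hb⟩ := eventually_atTop.1 hC
  refine IsBigO.of_bound (C * (-(s + 1))⁻¹) ?_
  filter_upwards [eventually_ge_atTop b, eventually_gt_atTop 0] with a hab ha
  calc ‖∫ x in Set.Ioi a, f x‖ ≤ ∫ x in Set.Ioi a, C * x ^ s := by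
        refine norm_integral_le_of_norm_le ((integrableOn_Ioi_rpow_of_lt hs ha).const_mul C) ?_
        filter_upwards [ae_restrict_mem measurableSet_Ioi] with x hx
        simpa [Real.abs_rpow_of_nonneg (ha.trans hx).le, abs_of_pos (ha.trans hx)]
          using hb x (hab.trans (le_of_lt hx))
    _ = C * (-(s + 1))⁻¹ * ‖a ^ (s + 1)‖ := by
        rw [integral_const_mul, integral_Ioi_rpow_of_lt hs ha,
          Real.norm_of_nonneg (Real.rpow_nonneg ha.le _), neg_div, ← div_neg, div_eq_inv_mul,
          mul_assoc]

/-- The constant that the Euler–Maclaurin formula of order `2M` gives in the expansion of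
`∑ k ≤ n, k ^ q * (log k) ^ p`. -/
noncomputable def constantOfOrder (p q M : ℕ) : ℝ :=
  -expansion p q M 1 - ∫ x in Set.Ioi (1 : ℝ), remainderIntegrand p q M x

theorem sum_pow_mul_log_pow_eq {p q M n : ℕ} (hp : 1 ≤ p) (hM : (q + 1) / 2 < M) (hn : 1 ≤ n) :
    ∑ k ∈ Finset.Icc 1 n, (k : ℝ) ^ q * Real.log k ^ p
      = expansion p q M n + constantOfOrder p q M
        + ∫ x in Set.Ioi (n : ℝ), remainderIntegrand p q M x := by
  have hn' : (1 : ℝ) ≤ n := by exact_mod_cast hn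
  have hint := integrableOn_remainderIntegrand p hM
  have heq : Set.EqOn (remainderIntegrand p q M) (fun x => dividedBernoulli (2 * M) (Int.fract x)
      • logPowDeriv p q (2 * M + 1) x) (Set.Ioi 1) :=
    fun x hx => remainderIntegrand_eq p q M (zero_lt_one.trans hx).ne'
  have hsum := eulerMaclaurin_sum (G := logPowDeriv p q)
    (fun j x hx => hasDerivAt_logPowDeriv p q j hx.ne') (by lia)
    (hint.congr_fun heq measurableSet_Ioi) hn
  have hone := eulerMaclaurinBoundary_logPowDeriv hp hM.le 1
  rw [Nat.cast_one] at hone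
  rw [eulerMaclaurinBoundary_logPowDeriv hp hM.le, hone, intervalIntegral.integral_of_le hn',
    ← setIntegral_congr_fun measurableSet_Ioc fun x hx => heq hx.1,
    ← intervalIntegral.integral_of_le hn', ← intervalIntegral.integral_Ioi_sub_Ioi hint hn']
    at hsum
  simp only [logPowDeriv_one, Real.log_one, zero_pow (show p ≠ 0 by lia), mul_zero] at hsum
  rw [hsum, constantOfOrder]
  ring

/-! ### Complex powers and their derivatives in the exponent -/

section ComplexPowers

open Polynomial (taylor)
open PowerSeries (coeff)

/-- A primitive of `x ↦ x ^ w` on `x > 0`, followed by this function and its successive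
derivatives. -/
noncomputable def cpowDeriv (w : ℂ) : ℕ → ℝ → ℂ
  | 0, x => (x : ℂ) ^ (w + 1) / (w + 1)
  | j + 1, x => (descPochhammer ℂ j).eval w * (x : ℂ) ^ (w - j)

theorem cpowDeriv_one (w : ℂ) (x : ℝ) : cpowDeriv w 1 x = (x : ℂ) ^ w := by
  simp [cpowDeriv]

theorem hasDerivAt_cpowDeriv {w : ℂ} (hw : w ≠ -1) (j : ℕ) {x : ℝ} (hx : x ≠ 0) :
    HasDerivAt (cpowDeriv w j) (cpowDeriv w (j + 1) x) x := by
  cases j with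
  | zero =>
    rw [zero_add, cpowDeriv_one]
    exact hasDerivAt_ofReal_cpow_const' hx hw
  | succ j =>
    rw [cpowDeriv, descPochhammer_succ_eval]
    obtain hwj | hwj := eq_or_ne (w - j) 0
    · have hconst : cpowDeriv w (j + 1) = fun _ => (descPochhammer ℂ j).eval w := by
        ext y
        rw [cpowDeriv, hwj, Complex.cpow_zero, mul_one]
      rw [hconst, hwj, mul_zero, zero_mul]
      exact hasDerivAt_const x _
    · refine ((hasDerivAt_ofReal_cpow_const hx hwj).const_mul _).congr_deriv ?_
      push_cast
      rw [mul_assoc, sub_sub]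

theorem analyticAt_const_cpow_add {a : ℂ} (ha : a ∈ Complex.slitPlane) (b w : ℂ) :
    AnalyticAt ℂ (fun z : ℂ => a ^ (z + b)) w :=
  analyticAt_const.cpow (by fun_prop) ha

theorem analyticAt_cpowDeriv {w : ℂ} (hw : w ≠ -1) (j : ℕ) {x : ℝ} (hx : 0 < x) :
    AnalyticAt ℂ (fun z : ℂ => cpowDeriv z j x) w := by
  have hcpow (b : ℂ) := analyticAt_const_cpow_add (Complex.ofReal_mem_slitPlane.2 hx) b w
  cases j with
  | zero =>
    exact (hcpow 1).fun_div (by fun_prop) fun h => hw (eq_neg_of_add_eq_zero_left h)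
  | succ j =>
    simpa only [sub_eq_add_neg, cpowDeriv]
      using ((descPochhammer ℂ j).differentiable.analyticAt w).fun_mul (hcpow (-j))

theorem iteratedDeriv_const_cpow_add {a : ℂ} (ha : a ≠ 0) (b w : ℂ) (n : ℕ) :
    iteratedDeriv n (fun z : ℂ => a ^ (z + b)) w = Complex.log a ^ n * a ^ (w + b) := by
  simp only [Complex.cpow_add _ b ha, Complex.cpow_def_of_ne_zero ha]
  rw [iteratedDeriv_mul_const_field, iteratedDeriv_cexp_const_mul, mul_assoc]

theorem iteratedDeriv_mul_const_cpow (p : ℕ) (m e : ℤ) {g : ℂ → ℂ} (hg : AnalyticAt ℂ g m)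
    {A : PowerSeries ℝ} (hA : ∀ r, iteratedDeriv r g m = (r.factorial * coeff r A : ℝ)) {x : ℝ}
    (hx : 0 < x) :
    iteratedDeriv p (fun z : ℂ => g z * (x : ℂ) ^ (z + e)) m
      = (logSum p A x * x ^ (m + e) : ℝ) := by
  have hchoose {r : ℕ} (hr : r ≤ p) :
      (p.choose r : ℂ) * r.factorial = (p.factorial : ℂ) / (p - r).factorial := by
    rw [eq_div_iff (by exact_mod_cast (p - r).factorial_ne_zero)]
    exact_mod_cast Nat.choose_mul_factorial_mul_factorial hr
  have hzpow : (x : ℂ) ^ ((m : ℂ) + e) = (x : ℂ) ^ (m + e) := by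
    rw [← Int.cast_add, Complex.cpow_intCast]
  rw [iteratedDeriv_fun_mul hg.contDiffAt (analyticAt_const_cpow_add
    (Complex.ofReal_mem_slitPlane.2 hx) e m).contDiffAt, logSum]
  push_cast
  rw [Finset.sum_mul]
  refine Finset.sum_congr rfl fun r hr => ?_
  rw [iteratedDeriv_const_cpow_add (by exact_mod_cast hx.ne'), hA,
    ← hchoose (Nat.lt_succ_iff.1 (Finset.mem_range.1 hr)), hzpow, Complex.ofReal_log hx.le]
  push_cast
  ring

theorem iteratedDeriv_inv_add_one {a : ℝ} (ha : a + 1 ≠ 0) (r : ℕ) :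
    iteratedDeriv r (fun z : ℂ => (z + 1)⁻¹) a
      = (r.factorial * coeff r (PowerSeries.X + PowerSeries.C (a + 1))⁻¹ : ℝ) := by
  have hiter := congrFun (iter_deriv_inv_linear (𝕜 := ℂ) r 1 1) a
  simp only [one_mul, one_pow, mul_one] at hiter
  rw [iteratedDeriv_eq_iterate, hiter, coeff_X_add_C_inv ha,
    show -1 - (r : ℤ) = -((r + 1 : ℕ) : ℤ) by push_cast; ring, zpow_neg, zpow_natCast]
  push_cast
  ring

theorem iteratedDeriv_polynomial_eval {K : Type*} [NontriviallyNormedField K] (P : Polynomial K)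
    (r : ℕ) (w : K) :
    iteratedDeriv r (fun z => P.eval z) w = r.factorial * (taylor w P).coeff r := by
  have hiter : iteratedDeriv r (fun z => P.eval z)
      = fun z => (Polynomial.derivative^[r] P).eval z := by
    induction r with
    | zero => simp
    | succ r ih =>
      rw [iteratedDeriv_succ, ih, Function.iterate_succ_apply']
      ext z
      exact Polynomial.deriv _
  rw [hiter, Polynomial.taylor_coeff, ← Polynomial.factorial_smul_hasseDeriv]
  simp

theorem iteratedDeriv_descPochhammer_eval (a : ℝ) (j r : ℕ) :
    iteratedDeriv r (fun z => (descPochhammer ℂ j).eval z) a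
      = (r.factorial * (taylor a (descPochhammer ℝ j)).coeff r : ℝ) := by
  rw [iteratedDeriv_polynomial_eval, ← descPochhammer_map Complex.ofRealHom,
    ← Complex.ofRealHom_eq_coe, ← Polynomial.map_taylor, Polynomial.coeff_map]
  simp

theorem iteratedDeriv_cpowDeriv (p q j : ℕ) {x : ℝ} (hx : 0 < x) :
    iteratedDeriv p (fun z : ℂ => cpowDeriv z j x) q = (logPowDeriv p q j x : ℝ) := by
  cases j with
  | zero =>
    have hq : (q : ℝ) + 1 ≠ 0 := by positivity
    have hg : AnalyticAt ℂ (fun z : ℂ => (z + 1)⁻¹) (q : ℤ) :=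
      AnalyticAt.fun_inv (by fun_prop) (by exact_mod_cast hq)
    simpa only [cpowDeriv, logPowDeriv, Int.cast_one, Int.cast_natCast, div_eq_inv_mul]
      using iteratedDeriv_mul_const_cpow p q 1 hg
        (fun r => by simpa using iteratedDeriv_inv_add_one hq r) hx
  | succ j =>
    simpa only [cpowDeriv, logPowDeriv, Int.cast_neg, Int.cast_natCast, ← sub_eq_add_neg]
      using iteratedDeriv_mul_const_cpow p q (-j)
        (A := (taylor (q : ℝ) (descPochhammer ℝ j) : PowerSeries ℝ))
        ((descPochhammer ℂ j).differentiable.analyticAt _)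
        (fun r => by simpa using iteratedDeriv_descPochhammer_eval q j r) hx

end ComplexPowers

/-! ### The Euler–Maclaurin approximation of the zeta function -/

theorem analyticAt_sum_natCast_cpow (n : ℕ) (w : ℂ) :
    AnalyticAt ℂ (fun z : ℂ => ∑ k ∈ Finset.Icc 1 n, (k : ℂ) ^ z) w :=
  Finset.analyticAt_fun_sum _ fun k hk => by
    simpa using analyticAt_const_cpow_add
      (Complex.natCast_mem_slitPlane.2 (Nat.one_le_iff_ne_zero.1 (Finset.mem_Icc.1 hk).1)) 0 w

theorem iteratedDeriv_sum_natCast_cpow (p q n : ℕ) :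
    iteratedDeriv p (fun z : ℂ => ∑ k ∈ Finset.Icc 1 n, (k : ℂ) ^ z) q
      = (∑ k ∈ Finset.Icc 1 n, (k : ℝ) ^ q * Real.log k ^ p : ℝ) := by
  have hk0 {k : ℕ} (hk : k ∈ Finset.Icc 1 n) : k ≠ 0 := Nat.one_le_iff_ne_zero.1
    (Finset.mem_Icc.1 hk).1
  have hterm {k : ℕ} (hk : k ∈ Finset.Icc 1 n) :
      iteratedDeriv p (fun z : ℂ => (k : ℂ) ^ z) q = (k : ℂ) ^ q * Complex.log k ^ p := by
    simpa [mul_comm] using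
      iteratedDeriv_const_cpow_add (Nat.cast_ne_zero.2 (hk0 hk) : (k : ℂ) ≠ 0) 0 q p
  have hanalytic {k : ℕ} (hk : k ∈ Finset.Icc 1 n) :
      AnalyticAt ℂ (fun z : ℂ => (k : ℂ) ^ z) q := by
    simpa using analyticAt_const_cpow_add (Complex.natCast_mem_slitPlane.2 (hk0 hk)) 0 (q : ℂ)
  rw [iteratedDeriv_fun_sum fun k hk => (hanalytic hk).contDiffAt]
  push_cast
  exact Finset.sum_congr rfl fun k hk => hterm hk

theorem analyticAt_eulerMaclaurinBoundary {G : ℂ → ℕ → ℝ → ℂ} {w : ℂ} {x : ℝ}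
    (hG : ∀ j, AnalyticAt ℂ (fun z => G z j x) w) (M : ℕ) :
    AnalyticAt ℂ (fun z => eulerMaclaurinBoundary (G z) M x) w := by
  simp only [eulerMaclaurinBoundary, Complex.real_smul]
  exact ((hG 0).fun_add (analyticAt_const.fun_mul (hG 1))).fun_add
    (Finset.analyticAt_fun_sum _ fun k _ => analyticAt_const.fun_mul (hG (2 * k)))

theorem iteratedDeriv_eulerMaclaurinBoundary {G : ℂ → ℕ → ℝ → ℂ} {w : ℂ} {x : ℝ}
    (hG : ∀ j, AnalyticAt ℂ (fun z => G z j x) w) (M p : ℕ) :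
    iteratedDeriv p (fun z => eulerMaclaurinBoundary (G z) M x) w
      = eulerMaclaurinBoundary (fun j x => iteratedDeriv p (fun z => G z j x) w) M x := by
  have hmul (b : ℝ) (j : ℕ) : AnalyticAt ℂ (fun z => (b : ℂ) * G z j x) w :=
    analyticAt_const.fun_mul (hG j)
  simp only [eulerMaclaurinBoundary, Complex.real_smul]
  rw [iteratedDeriv_fun_add ((hG 0).fun_add (hmul _ 1)).contDiffAt
      (Finset.analyticAt_fun_sum _ fun k _ => hmul _ (2 * k)).contDiffAt,
    iteratedDeriv_fun_add (hG 0).contDiffAt (hmul _ 1).contDiffAt,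
    iteratedDeriv_fun_sum fun k _ => (hmul _ (2 * k)).contDiffAt]
  simp only [iteratedDeriv_const_mul_field]

/-- The sum `∑_{k ≤ n} k ^ w` minus the boundary terms at `n` of its Euler–Maclaurin formula of
order `2M`; as `n → ∞` it approximates `ζ(-w)`. -/
noncomputable def zetaApprox (M n : ℕ) (w : ℂ) : ℂ :=
  ∑ k ∈ Finset.Icc 1 n, (k : ℂ) ^ w - eulerMaclaurinBoundary (cpowDeriv w) M n

theorem analyticAt_zetaApprox (M : ℕ) {n : ℕ} (hn : 1 ≤ n) {w : ℂ} (hw : w ≠ -1) :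
    AnalyticAt ℂ (zetaApprox M n) w :=
  (analyticAt_sum_natCast_cpow n w).fun_sub <|
    analyticAt_eulerMaclaurinBoundary (fun j => analyticAt_cpowDeriv hw j (by positivity)) M

theorem iteratedDeriv_zetaApprox (p q M : ℕ) {n : ℕ} (hn : 1 ≤ n) :
    iteratedDeriv p (zetaApprox M n) q
      = (∑ k ∈ Finset.Icc 1 n, (k : ℝ) ^ q * Real.log k ^ p
        - eulerMaclaurinBoundary (logPowDeriv p q) M n : ℝ) := by
  have hq : (q : ℂ) ≠ -1 := fun h => q.cast_add_one_ne_zero (eq_neg_iff_add_eq_zero.1 h)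
  have hanalytic (j : ℕ) : AnalyticAt ℂ (fun z => cpowDeriv z j n) q :=
    analyticAt_cpowDeriv hq j (by positivity)
  have hboundary : iteratedDeriv p (fun z => eulerMaclaurinBoundary (cpowDeriv z) M n) q
      = (eulerMaclaurinBoundary (logPowDeriv p q) M n : ℝ) := by
    rw [iteratedDeriv_eulerMaclaurinBoundary hanalytic]
    simp only [eulerMaclaurinBoundary, iteratedDeriv_cpowDeriv p q _ (by positivity : (0 : ℝ) < n),
      Complex.real_smul, smul_eq_mul]
    push_cast
    rfl
  rw [Complex.ofReal_sub, ← iteratedDeriv_sum_natCast_cpow, ← hboundary]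
  exact iteratedDeriv_fun_sub (analyticAt_sum_natCast_cpow n _).contDiffAt
    (analyticAt_eulerMaclaurinBoundary hanalytic M).contDiffAt

theorem zetaApprox_succ_sub {M n : ℕ} (hM : 1 ≤ M) (hn : 1 ≤ n) {w : ℂ} (hw : w ≠ -1) :
    zetaApprox M (n + 1) w - zetaApprox M n w
      = -∫ x in (n : ℝ)..n + 1,
          dividedBernoulli (2 * M) (Int.fract x) • cpowDeriv w (2 * M + 1) x := by
  have hn' : (1 : ℝ) ≤ n := by exact_mod_cast hn
  have hunit := eulerMaclaurin_unit (G := cpowDeriv w) (a := n) (fun j x hx =>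
    hasDerivAt_cpowDeriv hw j (by rw [Set.uIcc_of_le (by linarith)] at hx; linarith [hx.1])) hM
  rw [cpowDeriv_one, ← integral_dividedBernoulli_fract_smul] at hunit
  rw [zetaApprox, zetaApprox, Finset.sum_Icc_succ_top (by lia), Nat.cast_succ, Nat.cast_succ,
    show ((n : ℂ) + 1) = ((n + 1 : ℝ) : ℂ) by push_cast; rfl, hunit]
  abel

theorem norm_cpowDeriv_succ_le {w : ℂ} {σ : ℝ} {j : ℕ} (hw : w.re ≤ σ) (hσ : σ ≤ j) {a x : ℝ}
    (ha : 1 ≤ a) (hx : a ≤ x) :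
    ‖cpowDeriv w (j + 1) x‖ ≤ ‖(descPochhammer ℂ j).eval w‖ * a ^ (σ - j) := by
  rw [cpowDeriv, norm_mul, Complex.norm_cpow_eq_rpow_re_of_pos (by linarith), Complex.sub_re,
    Complex.natCast_re]
  gcongr
  exact (Real.rpow_le_rpow_of_exponent_le (ha.trans hx) (by linarith)).trans
    (Real.rpow_le_rpow_of_nonpos (by linarith) hx (by linarith))

theorem exists_norm_zetaApprox_succ_sub_le {M : ℕ} (hM : 1 ≤ M) :
    ∃ C : ℝ, 0 < C ∧ ∀ w : ℂ, w ≠ -1 → ∀ σ : ℝ, w.re ≤ σ → σ ≤ 2 * M → ∀ n : ℕ, 1 ≤ n →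
      ‖zetaApprox M (n + 1) w - zetaApprox M n w‖
        ≤ C * (‖(descPochhammer ℂ (2 * M)).eval w‖ * (n : ℝ) ^ (σ - 2 * M)) := by
  obtain ⟨C, hC, hbernoulli⟩ := exists_abs_dividedBernoulli_fract_le (2 * M)
  refine ⟨C, hC, fun w hw σ hσ hσM n hn => ?_⟩
  have hn' : (1 : ℝ) ≤ n := by exact_mod_cast hn
  have hintegrand : ∀ x ∈ Set.uIoc (n : ℝ) (n + 1),
      ‖dividedBernoulli (2 * M) (Int.fract x) • cpowDeriv w (2 * M + 1) x‖
        ≤ C * (‖(descPochhammer ℂ (2 * M)).eval w‖ * (n : ℝ) ^ (σ - 2 * M)) := by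
    intro x hx
    rw [Set.uIoc_of_le (by linarith)] at hx
    have hderiv := norm_cpowDeriv_succ_le hσ (j := 2 * M) (by exact_mod_cast hσM) hn' hx.1.le
    rw [norm_smul]
    push_cast at hderiv
    gcongr
    exact hbernoulli x
  rw [zetaApprox_succ_sub hM hn hw, norm_neg]
  simpa using intervalIntegral.norm_integral_le_of_norm_le_const hintegrand

theorem exists_tendstoLocallyUniformlyOn_of_summable_sub {X E : Type*} [TopologicalSpace X]
    [NormedAddCommGroup E] {F : ℕ → X → E} {s : Set X}
    (hF : SummableLocallyUniformlyOn (fun n x => F (n + 1) x - F n x) s) :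
    ∃ f, TendstoLocallyUniformlyOn F f atTop s := by
  have hconst : TendstoLocallyUniformlyOn (fun _ : ℕ => F 0) (F 0) atTop s :=
    TendstoUniformlyOn.tendstoLocallyUniformlyOn fun u hu =>
      Eventually.of_forall fun _ _ _ => refl_mem_uniformity hu
  refine ⟨_, (hconst.add
    hF.hasSumLocallyUniformlyOn.tendstoLocallyUniformlyOn_finsetRange).congr fun n x _ => ?_⟩
  simp only [Pi.add_apply, Finset.sum_range_sub (F · x), add_sub_cancel]

/-- The domain on which `zetaApprox M n` converges as `n → ∞`. -/
def approxDomain (M : ℕ) : Set ℂ := {w | w.re < 2 * M - 1 ∧ w ≠ -1}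

theorem isOpen_approxDomain (M : ℕ) : IsOpen (approxDomain M) :=
  (isOpen_lt Complex.continuous_re continuous_const).inter isOpen_ne

theorem isPreconnected_approxDomain {M : ℕ} (hM : 1 ≤ M) : IsPreconnected (approxDomain M) := by
  have hM' : (1 : ℝ) ≤ M := by exact_mod_cast hM
  have hcover : approxDomain M = {w : ℂ | w.re < 2 * M - 1} ∩ {w | w.re < -1}
      ∪ {w : ℂ | w.re < 2 * M - 1} ∩ {w | 0 < w.im} ∪ {w : ℂ | w.re < 2 * M - 1} ∩ {w | -1 < w.re}
      ∪ {w : ℂ | w.re < 2 * M - 1} ∩ {w | w.im < 0} := by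
    ext w
    simp only [approxDomain, ne_eq, Complex.ext_iff, Set.mem_union, Set.mem_inter_iff,
      Set.mem_ofPred_eq, Complex.neg_re, Complex.one_re, Complex.neg_im, Complex.one_im, neg_zero]
    grind
  have hconvex {V : Set ℂ} (hV : Convex ℝ V) :
      IsPreconnected ({w : ℂ | w.re < 2 * M - 1} ∩ V) :=
    ((convex_halfSpace_re_lt _).inter hV).isPreconnected
  rw [hcover]
  refine (((hconvex (convex_halfSpace_re_lt _)).union' ⟨⟨-2, 1⟩, ?_⟩
    (hconvex (convex_halfSpace_im_gt _))).union' ⟨⟨0, 1⟩, ?_⟩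
    (hconvex (convex_halfSpace_re_gt _))).union' ⟨⟨0, -1⟩, ?_⟩ (hconvex (convex_halfSpace_im_lt _))
  · exact ⟨⟨by simp; linarith, by simp⟩, by simp; linarith, by simp⟩
  · exact ⟨Or.inr ⟨by simp; linarith, by simp⟩, by simp; linarith, by simp⟩
  · exact ⟨Or.inr ⟨by simp; linarith, by simp⟩, by simp; linarith, by simp⟩

theorem exists_tendstoLocallyUniformlyOn_zetaApprox {M : ℕ} (hM : 1 ≤ M) :
    ∃ L, TendstoLocallyUniformlyOn (fun n => zetaApprox M (n + 1)) L atTop (approxDomain M) := by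
  obtain ⟨C, hC, hbound⟩ := exists_norm_zetaApprox_succ_sub_le hM
  refine exists_tendstoLocallyUniformlyOn_of_summable_sub <|
    SummableLocallyUniformlyOn_of_locally_bounded (isOpen_approxDomain M) fun K hKM hK => ?_
  obtain ⟨σ, hσM, hσ⟩ : ∃ σ < 2 * (M : ℝ) - 1, ∀ w ∈ K, w.re ≤ σ :=
    hK.exists_forall_le' (α := ℝᵒᵈ) Complex.continuous_re.continuousOn fun w hw => (hKM hw).1
  obtain ⟨B, hB⟩ := hK.exists_bound_of_continuousOn
    (descPochhammer ℂ (2 * M)).continuous.continuousOn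
  refine ⟨fun n => C * (B * ((n + 1 : ℕ) : ℝ) ^ (σ - 2 * M)), ?_, fun n w hw => ?_⟩
  · exact (((summable_nat_add_iff 1).2
      (Real.summable_nat_rpow.2 (by linarith))).mul_left B).mul_left C
  · refine (hbound w (hKM hw).2 σ (hσ w hw) (by linarith) (n + 1) (by lia)).trans ?_
    exact mul_le_mul_of_nonneg_left (mul_le_mul_of_nonneg_right (hB w hw) (by positivity)) hC.le

theorem tendsto_natCast_cpow_zero {v : ℂ} (hv : v.re < 0) :
    Tendsto (fun n : ℕ => ((n : ℝ) : ℂ) ^ v) atTop (nhds 0) := by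
  have hnorm := (tendsto_rpow_neg_atTop (neg_pos.2 hv)).comp (tendsto_natCast_atTop_atTop (R := ℝ))
  rw [neg_neg] at hnorm
  refine tendsto_zero_iff_norm_tendsto_zero.2 (hnorm.congr' ?_)
  filter_upwards [eventually_gt_atTop 0] with n hn
  exact (Complex.norm_cpow_eq_rpow_re_of_pos (by positivity) v).symm

theorem tendsto_cpowDeriv_zero {w : ℂ} (hw : w.re < -1) (j : ℕ) :
    Tendsto (fun n : ℕ => cpowDeriv w j n) atTop (nhds 0) := by
  cases j with
  | zero =>
    simpa only [cpowDeriv, zero_div] using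
      (tendsto_natCast_cpow_zero (v := w + 1) (by simp; linarith)).div_const (w + 1)
  | succ j =>
    simpa only [cpowDeriv, mul_zero] using
      (tendsto_natCast_cpow_zero (v := w - j) (by simp; linarith)).const_mul _

theorem tendsto_sum_natCast_cpow {w : ℂ} (hw : w.re < -1) :
    Tendsto (fun n : ℕ => ∑ k ∈ Finset.Icc 1 n, (k : ℂ) ^ w) atTop (nhds (riemannZeta (-w))) := by
  have hre : 1 < (-w).re := by simpa using neg_lt_neg hw
  have hsum : Summable fun n : ℕ => 1 / ((n : ℂ) + 1) ^ (-w) := by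
    simpa using (summable_nat_add_iff 1).2 (Complex.summable_one_div_nat_cpow.2 hre)
  have htendsto := hsum.hasSum.tendsto_sum_nat
  rw [← zeta_eq_tsum_one_div_nat_add_one_cpow hre] at htendsto
  refine htendsto.congr fun n => ?_
  have hshift := Finset.sum_Ico_add' (fun k : ℕ => (k : ℂ) ^ w) 0 n 1
  rw [zero_add, Finset.Ico_add_one_right_eq_Icc] at hshift
  rw [← hshift, Finset.range_eq_Ico]
  refine Finset.sum_congr rfl fun k _ => ?_
  rw [Complex.cpow_neg, one_div, inv_inv, Nat.cast_succ]

theorem tendsto_zetaApprox_of_re_lt (M : ℕ) {w : ℂ} (hw : w.re < -1) :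
    Tendsto (fun n => zetaApprox M n w) atTop (nhds (riemannZeta (-w))) := by
  have hboundary : Tendsto (fun n : ℕ => eulerMaclaurinBoundary (cpowDeriv w) M n) atTop
      (nhds 0) := by
    simpa only [eulerMaclaurinBoundary, smul_zero, add_zero, Finset.sum_const_zero] using
      ((tendsto_cpowDeriv_zero hw 0).add ((tendsto_cpowDeriv_zero hw 1).const_smul (1 / 2 : ℝ))).add
        (tendsto_finsetSum (Finset.Icc 1 M) fun k _ =>
          (tendsto_cpowDeriv_zero hw (2 * k)).const_smul
            ((bernoulli (2 * k) : ℝ) / ((2 * k).factorial : ℝ)))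
  simpa only [zetaApprox, sub_zero] using (tendsto_sum_natCast_cpow hw).sub hboundary

theorem differentiableOn_riemannZeta_neg (M : ℕ) :
    DifferentiableOn ℂ (fun w => riemannZeta (-w)) (approxDomain M) := fun w hw =>
  have hw' : -w ≠ 1 := fun h => hw.2 (by rw [← h, neg_neg])
  ((differentiableAt_riemannZeta hw').comp w differentiableAt_id.neg).differentiableWithinAt

theorem differentiableOn_zetaApprox (M n : ℕ) :
    DifferentiableOn ℂ (zetaApprox M (n + 1)) (approxDomain M) := fun _ hw =>
  (analyticAt_zetaApprox M (by lia) hw.2).differentiableAt.differentiableWithinAt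

theorem tendstoLocallyUniformlyOn_zetaApprox {M : ℕ} (hM : 1 ≤ M) :
    TendstoLocallyUniformlyOn (fun n => zetaApprox M (n + 1)) (fun w => riemannZeta (-w)) atTop
      (approxDomain M) := by
  have hM' : (1 : ℝ) ≤ M := by exact_mod_cast hM
  have hopen := isOpen_approxDomain M
  obtain ⟨L, hL⟩ := exists_tendstoLocallyUniformlyOn_zetaApprox hM
  have hL_analytic : AnalyticOnNhd ℂ L (approxDomain M) :=
    (hL.differentiableOn (Eventually.of_forall (differentiableOn_zetaApprox M)) hopen).analyticOnNhd
      hopen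
  have hmem : (-2 : ℂ) ∈ approxDomain M := ⟨by simp; linarith, by norm_num⟩
  have hhalfPlane : {w : ℂ | w.re < -1} ∈ nhds (-2 : ℂ) :=
    (isOpen_lt Complex.continuous_re continuous_const).mem_nhds (by simp)
  refine hL.congr_right <| hL_analytic.eqOn_of_preconnected_of_eventuallyEq
    ((differentiableOn_riemannZeta_neg M).analyticOnNhd hopen) (isPreconnected_approxDomain hM)
    hmem ?_
  filter_upwards [hhalfPlane, hopen.mem_nhds hmem] with w hw hwM
  exact tendsto_nhds_unique (hL.tendsto_at hwM)
    ((tendsto_add_atTop_iff_nat 1).2 (tendsto_zetaApprox_of_re_lt M hw))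

theorem differentiableOn_iteratedDeriv {f : ℂ → ℂ} {U : Set ℂ} (hU : IsOpen U)
    (hf : DifferentiableOn ℂ f U) (p : ℕ) : DifferentiableOn ℂ (iteratedDeriv p f) U := by
  induction p with
  | zero => rwa [iteratedDeriv_zero]
  | succ p ih =>
    rw [iteratedDeriv_succ]
    exact ih.deriv hU

theorem tendstoLocallyUniformlyOn_iteratedDeriv {ι : Type*} {l : Filter ι} {F : ι → ℂ → ℂ}
    {f : ℂ → ℂ} {U : Set ℂ} (hU : IsOpen U) (hF : ∀ n, DifferentiableOn ℂ (F n) U)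
    (h : TendstoLocallyUniformlyOn F f l U) (p : ℕ) :
    TendstoLocallyUniformlyOn (fun n => iteratedDeriv p (F n)) (iteratedDeriv p f) l U := by
  induction p with
  | zero => simpa only [iteratedDeriv_zero] using h
  | succ p ih =>
    simp only [iteratedDeriv_succ]
    exact ih.deriv (Eventually.of_forall fun n => differentiableOn_iteratedDeriv hU (hF n) p) hU

theorem tendsto_iteratedDeriv_zetaApprox (p : ℕ) {q M : ℕ} (hM : (q + 1) / 2 < M) :
    Tendsto (fun n => iteratedDeriv p (zetaApprox M (n + 1)) q) atTop
      (nhds ((-1) ^ p * iteratedDeriv p riemannZeta (-(q : ℂ)))) := by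
  have hmem : (q : ℂ) ∈ approxDomain M := by
    have hM' : (q : ℝ) + 1 < 2 * M := by exact_mod_cast (by lia : q + 1 < 2 * M)
    exact ⟨by simpa using by linarith, fun h =>
      q.cast_add_one_ne_zero (eq_neg_iff_add_eq_zero.1 h)⟩
  have h := (tendstoLocallyUniformlyOn_iteratedDeriv (isOpen_approxDomain M)
    (differentiableOn_zetaApprox M) (tendstoLocallyUniformlyOn_zetaApprox (by lia)) p).tendsto_at
    hmem
  rwa [iteratedDeriv_comp_neg, smul_eq_mul] at h

/-! ### The constant and the error term -/

theorem constantOfOrder_eq {p q M : ℕ} (hp : 1 ≤ p) (hM : (q + 1) / 2 < M) :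
    (constantOfOrder p q M : ℂ) = (-1) ^ p * iteratedDeriv p riemannZeta (-(q : ℂ))
      + (boundaryConstant p q : ℝ) := by
  have htail : Tendsto (fun n : ℕ => ∫ x in Set.Ioi ((n + 1 : ℕ) : ℝ), remainderIntegrand p q M x)
      atTop (nhds 0) :=
    tendsto_integral_Ioi_zero (tendsto_natCast_atTop_atTop.comp (tendsto_add_atTop_nat 1))
  have hlim : Tendsto (fun n => iteratedDeriv p (zetaApprox M (n + 1)) q) atTop
      (nhds ((constantOfOrder p q M - boundaryConstant p q : ℝ) : ℂ)) := by
    have hreal := htail.const_add (constantOfOrder p q M - boundaryConstant p q)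
    rw [add_zero] at hreal
    refine ((Complex.continuous_ofReal.tendsto _).comp hreal).congr fun n => ?_
    rw [iteratedDeriv_zetaApprox p q M (by lia), Function.comp_apply,
      sum_pow_mul_log_pow_eq hp hM (by lia), eulerMaclaurinBoundary_logPowDeriv hp hM.le]
    congr 1
    ring
  rw [tendsto_nhds_unique (tendsto_iteratedDeriv_zetaApprox p hM) hlim]
  push_cast
  ring

theorem constantOfOrder_congr {p q M N : ℕ} (hp : 1 ≤ p) (hM : (q + 1) / 2 < M)
    (hN : (q + 1) / 2 < N) : constantOfOrder p q M = constantOfOrder p q N :=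
  Complex.ofReal_injective <| (constantOfOrder_eq hp hM).trans (constantOfOrder_eq hp hN).symm

theorem log_pow_div_zpow_isBigO {i l : ℕ} (hil : i ≤ l) {a b : ℤ} (hab : b ≤ a) :
    (fun n : ℕ => Real.log n ^ i / (n : ℝ) ^ a) =O[atTop]
      fun n : ℕ => Real.log n ^ l / (n : ℝ) ^ b := by
  have hlog : ∀ᶠ n : ℕ in atTop, 1 ≤ Real.log n :=
    (Real.tendsto_log_atTop.comp tendsto_natCast_atTop_atTop).eventually_ge_atTop 1
  refine IsBigO.of_bound' ?_
  filter_upwards [hlog, eventually_ge_atTop 1] with n hlogn hn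
  have hn' : (1 : ℝ) ≤ n := by exact_mod_cast hn
  rw [Real.norm_of_nonneg (by positivity), Real.norm_of_nonneg (by positivity)]
  gcongr

theorem expansion_sub_expansion {p q m M : ℕ} (hmM : m ≤ M) (n : ℕ) :
    expansion p q M n - expansion p q m n
      = ∑ k ∈ Finset.Icc ((q + 1) / 2 + 1) M \ Finset.Icc ((q + 1) / 2 + 1) m,
          (∑ r ∈ Finset.Icc 1 p, d p q k r * Real.log n ^ (p - r)) / (n : ℝ) ^ (2 * k - q - 1) := by
  rw [Finset.sum_sdiff_eq_sub (Finset.Icc_subset_Icc_right hmM), expansion, expansion]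
  ring

theorem expansion_sub_expansion_isBigO (p q : ℕ) {m M : ℕ} (hmM : m ≤ M) :
    (fun n : ℕ => expansion p q M n - expansion p q m n) =O[atTop] fun n : ℕ =>
      Real.log n ^ (p - 1) / (n : ℝ) ^ (2 * (m : ℤ) - q) := by
  simp only [expansion_sub_expansion hmM, Finset.sum_div, mul_div_assoc, ← zpow_natCast]
  refine IsBigO.fun_sum fun k hk => IsBigO.fun_sum fun r hr => ?_
  simp only [Finset.mem_sdiff, Finset.mem_Icc] at hk hr
  exact (log_pow_div_zpow_isBigO (by lia) (by lia)).const_mul_left _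

theorem integral_remainderIntegrand_isBigO {p q m M : ℕ} (hM : (q + 1) / 2 < M) (hm : m < M) :
    (fun n : ℕ => ∫ x in Set.Ioi (n : ℝ), remainderIntegrand p q M x) =O[atTop] fun n : ℕ =>
      Real.log n ^ (p - 1) / (n : ℝ) ^ (2 * (m : ℤ) - q) := by
  have hq : (q : ℝ) + 2 ≤ 2 * M := by exact_mod_cast (by lia : q + 2 ≤ 2 * M)
  have htail := (integral_Ioi_isBigO_rpow (by linarith : (q : ℝ) - 2 * M + 1 / 2 < -1)
    (remainderIntegrand_isBigO_rpow p q M one_half_pos)).comp_tendsto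
      (tendsto_natCast_atTop_atTop (R := ℝ))
  refine htail.trans (IsBigO.trans (IsBigO.of_bound' ?_)
    (log_pow_div_zpow_isBigO (Nat.zero_le (p - 1)) le_rfl))
  filter_upwards [eventually_ge_atTop 1] with n hn
  have hn' : (1 : ℝ) ≤ n := by exact_mod_cast hn
  have hmM : (m : ℝ) + 1 ≤ M := by exact_mod_cast hm
  rw [Function.comp_apply, Real.norm_of_nonneg (by positivity), Real.norm_of_nonneg (by positivity),
    pow_zero, ← Real.rpow_intCast, one_div ((n : ℝ) ^ _), ← Real.rpow_neg n.cast_nonneg]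
  push_cast
  exact Real.rpow_le_rpow_of_exponent_le hn' (by linarith)

theorem sum_sub_expansion_isBigO {p q : ℕ} (hp : 1 ≤ p) (m : ℕ) :
    (fun n : ℕ => (∑ k ∈ Finset.Icc 1 n, (k : ℝ) ^ q * Real.log k ^ p)
        - (expansion p q m n + constantOfOrder p q ((q + 1) / 2 + 1)))
      =O[atTop] fun n : ℕ => Real.log n ^ (p - 1) / (n : ℝ) ^ (2 * (m : ℤ) - q) := by
  obtain ⟨M, hM, hmM⟩ : ∃ M, (q + 1) / 2 < M ∧ m < M := ⟨(q + 1) / 2 + m + 1, by lia, by lia⟩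
  refine ((expansion_sub_expansion_isBigO p q hmM.le).add
    (integral_remainderIntegrand_isBigO hM hmM)).congr' ?_ EventuallyEq.rfl
  filter_upwards [eventually_ge_atTop 1] with n hn
  rw [sum_pow_mul_log_pow_eq hp hM hn, constantOfOrder_congr hp (Nat.lt_succ_self _) hM]
  ring

end LogPowerSum

theorem mainTheorem2 (p q : ℕ) (hp : 1 ≤ p) :
    ∃ const : ℝ,
      -- the closed form of the constant
      (const : ℂ) = (-1) ^ p * iteratedDeriv p riemannZeta (-(q : ℂ))
          + (((bernoulli (q + 1) : ℝ) / ((q : ℝ) + 1) * (p.factorial : ℝ)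
              * LogPowerSum.S p 1 q : ℝ) : ℂ) ∧
      -- the asymptotic expansion to arbitrary order
      (∀ m : ℕ,
        (fun n : ℕ => (∑ k ∈ Finset.Icc 1 n, (k : ℝ) ^ q * Real.log k ^ p)
            - (LogPowerSum.expansion p q m n + const))
          =O[atTop] fun n : ℕ => Real.log n ^ (p - 1) / (n : ℝ) ^ (2 * (m : ℤ) - (q : ℤ))) ∧
      -- the Bernoulli sum for the constant, cut off at any order, with its remainder
      (∀ M : ℕ, (q + 1) / 2 + 1 ≤ M →
        IntegrableOn (LogPowerSum.remainderIntegrand p q M) (Set.Ioi 1) ∧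
        const = (-1) ^ (p + 1) * (p.factorial : ℝ) / ((q : ℝ) + 1) ^ (p + 1)
          - ∑ k ∈ Finset.Icc 1 (q / 2), LogPowerSum.c p q k p
          - ∑ k ∈ Finset.Icc ((q + 1) / 2 + 1) M, LogPowerSum.d p q k p
          - ∫ x in Set.Ioi (1 : ℝ), LogPowerSum.remainderIntegrand p q M x) := by
  have hmin : (q + 1) / 2 < (q + 1) / 2 + 1 := Nat.lt_succ_self _
  refine ⟨LogPowerSum.constantOfOrder p q ((q + 1) / 2 + 1), LogPowerSum.constantOfOrder_eq hp hmin,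
    LogPowerSum.sum_sub_expansion_isBigO hp,
    fun M hM => ⟨LogPowerSum.integrableOn_remainderIntegrand p hM, ?_⟩⟩
  rw [LogPowerSum.constantOfOrder_congr hp hmin hM, LogPowerSum.constantOfOrder,
    LogPowerSum.expansion_one hp, neg_neg]
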